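/- Consider the $(N,K)$ cache network: a server holds $N$ files of $F$ bits each, and each of $K$ users has a cache of $MF$ bits. In the placement phase every cache is filled with a function of the files, chosen without knowledge of the demands. Then each user $k$ requests a file $W_{d_k}$, and the server broadcasts to all users a message $X_{\mathbf d}$ that is a function of the files and of the demand vector $\mathbf d=(d_1,\dots,d_K)$, such that every user recovers its requested file without error from its cache and $X_{\mathbf d}$. Coding is allowed in both phases. The rate of a scheme is the largest size of $X_{\mathbf d}$, in units of $F$ bits, over the demands $\mathbf d$ in which every file is requested by at least one user. The pair $(M,R)$ is achievable if for every $\varepsilon>0$ and all sufficiently large $F$ there is a scheme with cache size at most $MF$ bits and rate at most $R+\varepsilon$. The exact rate memory tradeoff is $R^*(M)=\min\{R : (M,R)\text{ is achievable}\}$. Theorem. Let $N,K$ be integers with $2\le N\le \lfloor (K+1)/2\rfloor$. Then for every real $M$ with $\frac NK(K-2)\le M\le \frac NK(K-1)$ the minimum exists and $$R^*(M)=\frac{K^2+K-2}{K(K-1)}-\frac{K+1}{N(K-1)}\,M .$$ Moreover $(M,R^*(M))$ is already achievable by schemes with uncoded placement, that is, schemes in which every cached bit is a copy of a bit of some file.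 -/

import Mathlib

namespace CodedCaching

/-- The library of the server: `N` files of `F` bits each. -/
abbrev Files (N F : ℕ) : Type := Fin N → Fin F → Bool

/-- A demand vector: user `k` requests the file with index `d k`. -/
abbrev Demand (N K : ℕ) : Type := Fin K → Fin N

/-- A caching scheme for the `(N, K)` cache network with files of `F` bits.
The placement `cache` does not see the demand, and the broadcast message may have a length that
depends on the demand. Coding is allowed in both phases, and decoding has no error. -/
structure Scheme (N K F : ℕ) where
  /-- number of bits in the cache of each user -/
  cacheBits : ℕ
  /-- number of bits broadcast in response to a demand -/
  deliveryBits : Demand N K → ℕ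
  /-- placement phase: content of the cache of user `k` -/
  cache : Fin K → Files N F → (Fin cacheBits → Bool)
  /-- delivery phase: message broadcast in response to the demand `d` -/
  broadcast : (d : Demand N K) → Files N F → (Fin (deliveryBits d) → Bool)
  /-- decoder of user `k`, who knows the demand, its own cache and the broadcast message -/
  decode : (d : Demand N K) → Fin K → (Fin cacheBits → Bool) → (Fin (deliveryBits d) → Bool) →
    (Fin F → Bool)
  /-- every user recovers the requested file, for every content of the library -/
  decode_eq : ∀ (d : Demand N K) (k : Fin K) (W : Files N F),
    decode d k (cache k W) (broadcast d W) = W (d k)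

/-- The scheme fits the cache size `M` and the rate `R`, both in units of the file size `F`.
The rate is the largest over the demands in which every file is requested by some user. -/
def Scheme.Fits {N K F : ℕ} (S : Scheme N K F) (M R : ℝ) : Prop :=
  (S.cacheBits : ℝ) ≤ M * F ∧
    ∀ d : Demand N K, Function.Surjective d → (S.deliveryBits d : ℝ) ≤ R * F

/-- Uncoded placement: every bit in a cache is a copy of a bit of some file. -/
def Scheme.UncodedPlacement {N K F : ℕ} (S : Scheme N K F) : Prop :=
  ∀ (k : Fin K) (b : Fin S.cacheBits), ∃ (n : Fin N) (i : Fin F),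
    ∀ W : Files N F, S.cache k W b = W n i

/-- The memory rate pair `(M, R)` is achievable: for all sufficiently large file sizes there are
schemes with cache size `M` whose rate is at most `R`, up to an arbitrarily small excess. -/
def Achievable (N K : ℕ) (M R : ℝ) : Prop :=
  ∀ ε : ℝ, 0 < ε → ∃ F₀ : ℕ, ∀ F : ℕ, F₀ ≤ F → ∃ S : Scheme N K F, S.Fits M (R + ε)

/-- The memory rate pair `(M, R)` is achievable by schemes with uncoded placement. -/
def UncodedAchievable (N K : ℕ) (M R : ℝ) : Prop :=
  ∀ ε : ℝ, 0 < ε → ∃ F₀ : ℕ, ∀ F : ℕ, F₀ ≤ F →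
    ∃ S : Scheme N K F, S.UncodedPlacement ∧ S.Fits M (R + ε)

/-- `r` is the exact rate memory tradeoff at the cache size `M`, that is, the smallest rate `R`
for which `(M, R)` is achievable. -/
def IsExactRate (N K : ℕ) (M r : ℝ) : Prop :=
  IsLeast {R : ℝ | Achievable N K M R} r

end CodedCaching

/-! Converse: take the library uniform and measure information by entropies of partitions, where `⊓`
is joint knowledge and finer means more. Fix a file `s`, give away all other files, and for each
user `j` take a demand in which only `j` wants `s`. The cache of `j`, its message and the other
files then determine everything. Submodularity chains these facts along the users
(`card_mul_entropy_bot_le`); running the chain in both orders makes each user meet the message of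
every other user exactly once (`two_mul_entropy_bot_le`). Such a message costs little given the
cache, since it also reveals a file already given away. Averaging over cyclic shifts of the demands
leaves, for each user, only the cache entropy `H(Z)` and the sum of the `H(Z, W_n)`. The latter has
coefficient `2N - K - 1 ≤ 0`, so `le_sum_entropy_inf_filePart` eliminates it. Achievability: the
bound is a line through the points `(N(K-2)/K, 2/(K-1))` and `(N(K-1)/K, 1/K)`, both reached by
uncoded placement with XOR delivery; memory sharing fills the segment. -/

namespace CodedCaching

/-! ### Entropy of partitions: submodularity and the bit bound. -/

section Entropy

variable {Ω : Type*} [Fintype Ω]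

open Classical in
/-- The number of elements in the block of `x` in the partition given by `r`. -/
noncomputable def blockCard (r : Setoid Ω) (x : Ω) : ℕ := (Finset.univ.filter fun y => r x y).card

/-- The entropy, in bits, of the block of a uniformly random element of `Ω` in the partition
given by `r`. -/
noncomputable def entropy (r : Setoid Ω) : ℝ :=
  (∑ x, Real.logb 2 (Fintype.card Ω / blockCard r x)) / Fintype.card Ω

lemma blockCard_pos (r : Setoid Ω) (x : Ω) : 0 < blockCard r x := by
  classical
  exact Finset.card_pos.2 ⟨x, by simp⟩

lemma blockCard_congr (r : Setoid Ω) {x y : Ω} (h : r x y) : blockCard r x = blockCard r y := by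
  classical
  unfold blockCard
  congr 1
  ext z
  simp only [Finset.mem_filter, Finset.mem_univ, true_and]
  exact ⟨fun h' => r.trans (r.symm h) h', fun h' => r.trans h h'⟩

/-- Expand the numerator as a count of pairs `(y, z)` with `y` in the `a`-block and `z` in the
`b`-block of `x`. For a fixed pair the admissible `x` are empty or one block of `a ⊓ b`, and the
latter forces `c y z`, so the pair contributes at most `1 / blockCard c y`. -/
lemma sum_blockCard_ratio_le {a b c : Setoid Ω} (ha : a ≤ c) (hb : b ≤ c) :
    ∑ x, (blockCard a x * blockCard b x : ℝ) / (blockCard (a ⊓ b) x * blockCard c x) ≤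
      Fintype.card Ω := by
  classical
  have key : ∀ y z : Ω, ∑ x, (if a x y ∧ b x z then
      (1 : ℝ) / (blockCard (a ⊓ b) x * blockCard c x) else 0) ≤
      if c y z then (1 : ℝ) / blockCard c y else 0 := by
    intro y z
    by_cases h : ∃ x₀, a x₀ y ∧ b x₀ z
    · obtain ⟨x₀, h1, h2⟩ := h
      have hc : c y z := c.trans (c.symm (ha h1)) (hb h2)
      have : ∀ x, (if a x y ∧ b x z then
          (1 : ℝ) / (blockCard (a ⊓ b) x * blockCard c x) else 0) =
          if (a ⊓ b) x₀ x then (1 : ℝ) / (blockCard (a ⊓ b) x₀ * blockCard c y) else 0 := by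
        intro x
        have hiff : (a x y ∧ b x z) ↔ (a ⊓ b) x₀ x := by
          exact ⟨fun h => ⟨a.trans h1 (a.symm h.1), b.trans h2 (b.symm h.2)⟩,
            fun h => ⟨a.trans (a.symm h.1) h1, b.trans (b.symm h.2) h2⟩⟩
        by_cases hx : (a ⊓ b) x₀ x
        · rw [if_pos (hiff.2 hx), if_pos hx, blockCard_congr _ hx,
            blockCard_congr c (ha (hiff.2 hx).1)]
        · rw [if_neg (fun h => hx (hiff.1 h)), if_neg hx]
      rw [Finset.sum_congr rfl fun x _ => this x, if_pos hc, ← Finset.sum_filter,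
        Finset.sum_const, nsmul_eq_mul]
      have h3 : ((Finset.univ.filter fun y => (a ⊓ b) x₀ y).card : ℝ) = blockCard (a ⊓ b) x₀ := rfl
      rw [h3]
      have h4 := blockCard_pos (a ⊓ b) x₀
      have h5 := blockCard_pos c y
      apply le_of_eq
      field_simp
    · push Not at h
      rw [Finset.sum_eq_zero]
      · split_ifs <;> positivity
      · intro x _
        rw [if_neg]
        exact fun hx => h x hx.1 hx.2
  calc ∑ x, (blockCard a x * blockCard b x : ℝ) / (blockCard (a ⊓ b) x * blockCard c x)
      = ∑ x, ∑ y, ∑ z, (if a x y ∧ b x z then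
      (1 : ℝ) / (blockCard (a ⊓ b) x * blockCard c x) else 0) := by
        refine Finset.sum_congr rfl fun x _ => ?_
        have h1 : (blockCard a x : ℝ) = ∑ y, if a x y then 1 else 0 := by
          rw [Finset.sum_boole]; rfl
        have h2 : (blockCard b x : ℝ) = ∑ y, if b x y then 1 else 0 := by
          rw [Finset.sum_boole]; rfl
        rw [h1, h2, Finset.sum_mul_sum, Finset.sum_div]
        refine Finset.sum_congr rfl fun y _ => ?_
        rw [Finset.sum_div]
        refine Finset.sum_congr rfl fun z _ => ?_
        by_cases h3 : a x y <;> by_cases h4 : b x z <;> simp [h3, h4]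
    _ = ∑ y, ∑ z, ∑ x, (if a x y ∧ b x z then
      (1 : ℝ) / (blockCard (a ⊓ b) x * blockCard c x) else 0) := by
        rw [Finset.sum_comm]
        exact Finset.sum_congr rfl fun y _ => Finset.sum_comm
    _ ≤ ∑ y, ∑ z, if c y z then (1 : ℝ) / blockCard c y else 0 :=
        Finset.sum_le_sum fun y _ => Finset.sum_le_sum fun z _ => key y z
    _ = ∑ _y : Ω, (1 : ℝ) := by
        refine Finset.sum_congr rfl fun y _ => ?_
        rw [← Finset.sum_filter, Finset.sum_const, nsmul_eq_mul]
        have h3 : ((Finset.univ.filter fun z => c y z).card : ℝ) = blockCard c y := rfl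
        rw [h3]
        have := blockCard_pos c y
        field_simp
    _ = Fintype.card Ω := by simp

/-- Submodularity of the entropy. -/
lemma entropy_inf_add_le {a b c : Setoid Ω} (ha : a ≤ c) (hb : b ≤ c) :
    entropy (a ⊓ b) + entropy c ≤ entropy a + entropy b := by
  rcases isEmpty_or_nonempty Ω with hΩ | hΩ
  · simp [entropy]
  have hn : (0 : ℝ) < Fintype.card Ω := by exact_mod_cast Fintype.card_pos
  unfold entropy
  rw [← add_div, ← add_div, ← Finset.sum_add_distrib, ← Finset.sum_add_distrib]
  refine div_le_div_of_nonneg_right ?_ hn.le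
  rw [← sub_nonpos, ← Finset.sum_sub_distrib]
  have hl : (0 : ℝ) < Real.log 2 := Real.log_pos one_lt_two
  calc _ ≤ ∑ x, ((blockCard a x * blockCard b x : ℝ) / (blockCard (a ⊓ b) x * blockCard c x) - 1)
          / Real.log 2 := by
        refine Finset.sum_le_sum fun x _ => ?_
        have h1 : (0 : ℝ) < blockCard a x := by exact_mod_cast blockCard_pos a x
        have h2 : (0 : ℝ) < blockCard b x := by exact_mod_cast blockCard_pos b x
        have h3 : (0 : ℝ) < blockCard (a ⊓ b) x := by exact_mod_cast blockCard_pos (a ⊓ b) x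
        have h4 : (0 : ℝ) < blockCard c x := by exact_mod_cast blockCard_pos c x
        -- `log t ≤ t - 1` reduces the claim to the mean of the ratio being at most 1.
        have h := Real.log_le_sub_one_of_pos
          (x := (blockCard a x * blockCard b x : ℝ) / (blockCard (a ⊓ b) x * blockCard c x))
          (by positivity)
        rw [Real.log_div (by positivity) (by positivity), Real.log_mul h1.ne' h2.ne',
          Real.log_mul h3.ne' h4.ne'] at h
        unfold Real.logb
        rw [← add_div, ← add_div, ← sub_div]
        refine div_le_div_of_nonneg_right ?_ hl.le
        rw [Real.log_div hn.ne' h1.ne', Real.log_div hn.ne' h2.ne', Real.log_div hn.ne' h3.ne',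
          Real.log_div hn.ne' h4.ne']
        linarith
    _ ≤ 0 := by
        rw [← Finset.sum_div, Finset.sum_sub_distrib]
        refine div_nonpos_of_nonpos_of_nonneg ?_ hl.le
        have := sum_blockCard_ratio_le ha hb
        simpa using this

lemma entropy_anti {a b : Setoid Ω} (h : a ≤ b) : entropy b ≤ entropy a := by
  have := entropy_inf_add_le (a := a) (b := a) (c := b) h h
  rw [inf_idem] at this
  linarith

lemma entropy_top : entropy (⊤ : Setoid Ω) = 0 := by
  classical
  have : ∀ x : Ω, blockCard ⊤ x = Fintype.card Ω := fun x => by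
    simp [blockCard, Setoid.top_def]
  unfold entropy
  rw [Finset.sum_eq_zero, zero_div]
  intro x _
  have hx : (Fintype.card Ω : ℝ) ≠ 0 := by
    have := Fintype.card_pos_iff.2 ⟨x⟩
    positivity
  rw [this, div_self hx, Real.logb_one]

lemma entropy_bot [Nonempty Ω] : entropy (⊥ : Setoid Ω) = Real.logb 2 (Fintype.card Ω) := by
  classical
  have : ∀ x : Ω, blockCard ⊥ x = 1 := fun x => by
    simp [blockCard, Finset.filter_eq]
  have hn : (0 : ℝ) < Fintype.card Ω := by exact_mod_cast Fintype.card_pos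
  simp only [entropy, this, Nat.cast_one, div_one, Finset.sum_const, Finset.card_univ,
    nsmul_eq_mul]
  field_simp

lemma entropy_inf_le (a b : Setoid Ω) : entropy (a ⊓ b) ≤ entropy a + entropy b := by
  have := entropy_inf_add_le (a := a) (b := b) (c := ⊤) le_top le_top
  rwa [entropy_top, add_zero] at this

lemma entropy_ker_le [Nonempty Ω] {α : Type*} [Fintype α] (f : Ω → α) :
    entropy (Setoid.ker f) ≤ Real.logb 2 (Fintype.card α) := by
  classical
  have hn : (0 : ℝ) < Fintype.card Ω := by exact_mod_cast Fintype.card_pos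
  have hα : (0 : ℝ) < Fintype.card α := by
    have : Nonempty α := ‹Nonempty Ω›.map f
    exact_mod_cast Fintype.card_pos
  have hl : (0 : ℝ) < Real.log 2 := Real.log_pos one_lt_two
  have hb : ∀ x, (blockCard (Setoid.ker f) x : ℝ) =
      (Finset.univ.filter fun y => f y = f x).card := fun x => by
    simp only [blockCard, Setoid.ker_def, eq_comm]
  have hcount : ∑ x, (1 : ℝ) / blockCard (Setoid.ker f) x ≤ Fintype.card α := by
    rw [← Finset.sum_fiberwise (s := Finset.univ) (g := f)]
    calc _ ≤ ∑ _v : α, (1 : ℝ) := by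
          refine Finset.sum_le_sum fun v _ => ?_
          have : ∀ x ∈ Finset.univ.filter (fun y => f y = v),
              (1 : ℝ) / blockCard (Setoid.ker f) x =
              1 / (Finset.univ.filter fun y => f y = v).card := by
            intro x hx
            rw [hb, (Finset.mem_filter.1 hx).2]
          rw [Finset.sum_congr rfl this, Finset.sum_const, nsmul_eq_mul, mul_one_div]
          exact div_self_le_one _
      _ = Fintype.card α := by simp
  unfold entropy
  rw [div_le_iff₀ hn]
  have h1 : ∀ x, Real.logb 2 (Fintype.card Ω / blockCard (Setoid.ker f) x) ≤
      Real.logb 2 (Fintype.card α) +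
      ((Fintype.card Ω / Fintype.card α : ℝ) * (1 / blockCard (Setoid.ker f) x) - 1)
        / Real.log 2 := by
    intro x
    have h1 : (0 : ℝ) < blockCard (Setoid.ker f) x := by exact_mod_cast blockCard_pos _ x
    have h := Real.log_le_sub_one_of_pos
      (x := (Fintype.card Ω / Fintype.card α : ℝ) * (1 / blockCard (Setoid.ker f) x))
      (by positivity)
    rw [Real.log_mul (by positivity) (by positivity), Real.log_div hn.ne' hα.ne', one_div,
      Real.log_inv] at h
    unfold Real.logb
    rw [← add_div]
    refine div_le_div_of_nonneg_right ?_ hl.le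
    rw [Real.log_div hn.ne' h1.ne', one_div]
    linarith
  refine (Finset.sum_le_sum fun x _ => h1 x).trans ?_
  rw [Finset.sum_add_distrib, ← Finset.sum_div, Finset.sum_sub_distrib, ← Finset.mul_sum]
  simp only [Finset.sum_const, Finset.card_univ, nsmul_eq_mul, mul_one]
  have h2 : (Fintype.card Ω / Fintype.card α : ℝ) *
      ∑ x, (1 : ℝ) / blockCard (Setoid.ker f) x ≤ Fintype.card Ω :=
    (mul_le_mul_of_nonneg_left hcount (by positivity)).trans_eq (by field_simp)
  have h3 := div_nonpos_of_nonpos_of_nonneg (sub_nonpos.2 h2) hl.le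
  linarith

lemma entropy_ker_bits_le [Nonempty Ω] {n : ℕ} (f : Ω → (Fin n → Bool)) :
    entropy (Setoid.ker f) ≤ n := by
  refine (entropy_ker_le f).trans_eq ?_
  simp [Real.logb_pow]

/-! ### Chaining entropies along the users. -/

/-- The joint entropy is at most the sum of the conditional entropies given `a`. -/
lemma entropy_inf_finset_inf_le {ι : Type*} (a : Setoid Ω) (s : Finset ι) (x : ι → Setoid Ω) :
    entropy (a ⊓ s.inf x) ≤ entropy a + ∑ j ∈ s, (entropy (a ⊓ x j) - entropy a) := by
  classical
  induction s using Finset.induction_on with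
  | empty => simp
  | insert i s hi ih =>
    rw [Finset.inf_insert, Finset.sum_insert hi]
    have := entropy_inf_add_le (a := a ⊓ x i) (b := a ⊓ s.inf x) (c := a) inf_le_left inf_le_left
    rw [← inf_inf_distrib_left] at this
    linarith

/-- If `z k`, `c` and `x k` determine everything for every `k`, then the `z k` together with the
earlier `x j` carry much entropy. -/
lemma card_mul_entropy_bot_le {ι : Type*} [LinearOrder ι] (s : Finset ι) (c : Setoid Ω)
    (z x : ι → Setoid Ω) (h : ∀ k, z k ⊓ c ⊓ x k ≤ ⊥) :
    s.card * entropy (⊥ : Setoid Ω) + entropy c ≤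
      ∑ k ∈ s, entropy (z k ⊓ c ⊓ (s.filter (· < k)).inf x) + entropy (c ⊓ s.inf x) := by
  induction s using Finset.induction_on_max with
  | empty => simp
  | insert i s hi ih =>
    have hni : i ∉ s := fun h => lt_irrefl _ (hi i h)
    have h1 : (insert i s).filter (· < i) = s := by
      ext j
      simp only [Finset.mem_filter, Finset.mem_insert]
      exact ⟨fun h => h.1.resolve_left h.2.ne, fun h => ⟨Or.inr h, hi j h⟩⟩
    have h2 : ∀ k ∈ s, (insert i s).filter (· < k) = s.filter (· < k) := by
      intro k hk
      rw [Finset.filter_insert, if_neg (hi k hk).not_gt]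
    rw [Finset.sum_insert hni, h1, Finset.card_insert_of_notMem hni, Finset.inf_insert,
      Finset.sum_congr rfl fun k hk => by rw [h2 k hk]]
    -- The two partitions share `c ⊓ s.inf x` and jointly determine everything, so the new largest
    -- user adds one full entropy and the chain telescopes.
    have h3 := entropy_inf_add_le (a := z i ⊓ c ⊓ s.inf x) (b := c ⊓ (x i ⊓ s.inf x))
      (c := c ⊓ s.inf x) (inf_le_inf_right _ inf_le_right) (inf_le_inf_left _ inf_le_right)
    have h4 : z i ⊓ c ⊓ s.inf x ⊓ (c ⊓ (x i ⊓ s.inf x)) = ⊥ := by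
      refine le_bot_iff.1 (le_trans ?_ (h i))
      refine le_inf (inf_le_left.trans inf_le_left) ?_
      exact inf_le_right.trans (inf_le_right.trans inf_le_left)
    rw [h4] at h3
    push_cast
    linarith

/-- The users before `k` in one order are those after `k` in the reversed order, so adding both
chains yields a sum over all `j ≠ k`. Bounding the final joint entropy of each chain by the full
entropy turns `K` into `K - 1`. -/
lemma two_mul_entropy_bot_le {K : ℕ} (c : Setoid Ω) (z x : Fin K → Setoid Ω)
    (h : ∀ k, z k ⊓ c ⊓ x k ≤ ⊥) :
    2 * ((K : ℝ) - 1) * entropy (⊥ : Setoid Ω) + 2 * entropy c ≤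
      ∑ k, (2 * entropy (z k ⊓ c) +
        ∑ j ∈ Finset.univ.erase k, (entropy (z k ⊓ c ⊓ x j) - entropy (z k ⊓ c))) := by
  have h1 := card_mul_entropy_bot_le (Finset.univ : Finset (Fin K)) c z x h
  have h2 := card_mul_entropy_bot_le (ι := (Fin K)ᵒᵈ) Finset.univ c z x h
  have h3 : entropy (c ⊓ (Finset.univ : Finset (Fin K)).inf x) ≤ entropy (⊥ : Setoid Ω) :=
    entropy_anti bot_le
  have h4 : entropy (c ⊓ (Finset.univ : Finset (Fin K)ᵒᵈ).inf x) ≤ entropy (⊥ : Setoid Ω) :=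
    entropy_anti bot_le
  have h5 : ∑ k : Fin K, entropy (z k ⊓ c ⊓ (Finset.univ.filter (· < k)).inf x) +
      ∑ k : Fin K, entropy (z k ⊓ c ⊓ (Finset.univ.filter (fun j => k < j)).inf x) ≤
      ∑ k, (2 * entropy (z k ⊓ c) +
        ∑ j ∈ Finset.univ.erase k, (entropy (z k ⊓ c ⊓ x j) - entropy (z k ⊓ c))) := by
    rw [← Finset.sum_add_distrib]
    refine Finset.sum_le_sum fun k _ => ?_
    have e1 := entropy_inf_finset_inf_le (z k ⊓ c) (Finset.univ.filter (· < k)) x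
    have e2 := entropy_inf_finset_inf_le (z k ⊓ c) (Finset.univ.filter (fun j => k < j)) x
    have e3 : Finset.univ.erase k =
        Finset.univ.filter (· < k) ∪ Finset.univ.filter (fun j => k < j) := by
      ext j
      simp
    rw [e3, Finset.sum_union]
    · linarith
    · refine Finset.disjoint_filter.2 fun j _ hj hj' => lt_asymm hj hj'
  have h6 : ∑ k : (Fin K)ᵒᵈ, entropy (z k ⊓ c ⊓ (Finset.univ.filter (· < k)).inf x) =
      ∑ k : Fin K, entropy (z k ⊓ c ⊓ (Finset.univ.filter (fun j => k < j)).inf x) := rfl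
  rw [h6] at h2
  simp only [Finset.card_univ, Fintype.card_fin, Fintype.card_orderDual] at h1 h2
  linarith

end Entropy

/-! ### Entropies of files and of their complements. -/

/-- The partition of the library by the content of the file `n`. -/
abbrev filePart {N F : ℕ} (n : Fin N) : Setoid (Files N F) := Setoid.ker fun W => W n

/-- The partition of the library by the content of all files except the file `n`. -/
def otherFilesPart {N F : ℕ} (n : Fin N) : Setoid (Files N F) :=
  (Finset.univ.erase n).inf filePart

lemma otherFilesPart_le {N F : ℕ} {n i : Fin N} (h : i ≠ n) :
    (otherFilesPart n : Setoid (Files N F)) ≤ filePart i :=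
  Finset.inf_le (Finset.mem_erase.2 ⟨h, Finset.mem_univ i⟩)

lemma inf_filePart (N F : ℕ) : Finset.univ.inf (filePart : Fin N → Setoid (Files N F)) = ⊥ := by
  refine le_bot_iff.1 fun W W' h => ?_
  have h' : ∀ n, (filePart n : Setoid (Files N F)) W W' := fun n =>
    (Finset.inf_le (Finset.mem_univ n) : Finset.univ.inf filePart ≤ filePart n) h
  exact funext h'

lemma otherFilesPart_inf_filePart {N F : ℕ} (n : Fin N) :
    (otherFilesPart n : Setoid (Files N F)) ⊓ filePart n = ⊥ := by
  rw [← inf_filePart, otherFilesPart, inf_comm, ← Finset.inf_insert,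
    Finset.insert_erase (Finset.mem_univ n)]

lemma entropy_bot_files (N F : ℕ) : entropy (⊥ : Setoid (Files N F)) = N * F := by
  rw [entropy_bot]
  simp [Real.logb_pow]

lemma entropy_filePart_le {N F : ℕ} (n : Fin N) :
    entropy (filePart n : Setoid (Files N F)) ≤ F :=
  entropy_ker_bits_le _

lemma le_entropy_otherFilesPart {N F : ℕ} (n : Fin N) :
    ((N : ℝ) - 1) * F ≤ entropy (otherFilesPart n : Setoid (Files N F)) := by
  have h1 := entropy_inf_le (otherFilesPart n : Setoid (Files N F)) (filePart n)
  rw [otherFilesPart_inf_filePart, entropy_bot_files] at h1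
  have h2 := entropy_filePart_le (F := F) n
  linarith

/-- Together with all files, a partition has the full entropy. -/
lemma le_sum_entropy_inf_filePart {N F : ℕ} (z : Setoid (Files N F)) :
    ((N : ℝ) - 1) * entropy z + N * F ≤ ∑ n, entropy (z ⊓ filePart n) := by
  have h := entropy_inf_finset_inf_le z Finset.univ filePart
  rw [inf_filePart, inf_bot_eq, entropy_bot_files, Finset.sum_sub_distrib] at h
  simp only [Finset.sum_const, Finset.card_univ, Fintype.card_fin, nsmul_eq_mul] at h
  linarith

/-- Subadditivity given `z`: each file lies in the complement of `N - 1` files, so its conditional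
entropy is counted `N - 1` times. -/
lemma sum_entropy_inf_otherFilesPart_le {N F : ℕ} (z : Setoid (Files N F)) :
    ∑ n, entropy (z ⊓ otherFilesPart n) ≤
      N * entropy z + ((N : ℝ) - 1) * (∑ n, entropy (z ⊓ filePart n) - N * entropy z) := by
  have h : ∀ n, entropy (z ⊓ otherFilesPart n) ≤ entropy z +
      ((∑ i, entropy (z ⊓ filePart i) - N * entropy z) -
        (entropy (z ⊓ filePart n) - entropy z)) := by
    intro n
    refine (entropy_inf_finset_inf_le z (Finset.univ.erase n) filePart).trans_eq ?_
    have := Finset.add_sum_erase Finset.univ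
      (fun i => entropy (z ⊓ filePart i) - entropy z) (Finset.mem_univ n)
    rw [Finset.sum_sub_distrib (s := Finset.univ)] at this
    simp only [Finset.sum_const, Finset.card_univ, Fintype.card_fin, nsmul_eq_mul] at this
    linarith
  refine (Finset.sum_le_sum fun n _ => h n).trans_eq ?_
  simp only [Finset.sum_add_distrib, Finset.sum_sub_distrib, Finset.sum_const, Finset.card_univ,
    Fintype.card_fin, nsmul_eq_mul]
  ring

/-! ### The outer bound. -/

/-- There is a demand in which all files are requested, and only `j` requests the first one. -/
lemma exists_demand_unique {N K : ℕ} [NeZero N] (hNK : N ≤ K) (hN : 2 ≤ N) (j : Fin K) :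
    ∃ d : Demand N K, Function.Surjective d ∧ ∀ k, d k = 0 ↔ k = j := by
  classical
  have hcard : Fintype.card {n : Fin N // n ≠ 0} ≤ Fintype.card {k : Fin K // k ≠ j} := by
    simp only [ne_eq, Fintype.card_subtype_compl, Fintype.card_fin, Fintype.card_unique]
    omega
  -- A left inverse of this embedding maps the users other than `j` onto the nonzero files.
  obtain ⟨f⟩ := Function.Embedding.nonempty_of_card_le hcard
  have : Nonempty {n : Fin N // n ≠ 0} :=
    ⟨⟨⟨1, by omega⟩, fun h => by simpa using congrArg Fin.val h⟩⟩
  refine ⟨fun k => if h : k = j then 0 else (Function.invFun f ⟨k, h⟩ : {n : Fin N // n ≠ 0}),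
    fun n => ?_, fun k => ?_⟩
  · by_cases hn : n = 0
    · exact ⟨j, by simp [hn]⟩
    · refine ⟨f ⟨n, hn⟩, ?_⟩
      refine (dif_neg (f ⟨n, hn⟩).2).trans ?_
      simp [Function.leftInverse_invFun f.injective _]
  · by_cases h : k = j
    · simp [h]
    · simpa [h] using (Function.invFun f ⟨k, h⟩ : {n : Fin N // n ≠ 0}).2

/-- The outer bound. -/
theorem Scheme.Fits.le_of_two_mul_le {N K F : ℕ} (hN : 2 ≤ N) (hNK : 2 * N ≤ K + 1) (hF : 0 < F)
    {S : Scheme N K F} {M R : ℝ} (hS : S.Fits M R) :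
    (N : ℝ) * ((K : ℝ) - 1) * (K + 2) ≤ K * ((K : ℝ) + 1) * M + N * (K * ((K : ℝ) - 1)) * R := by
  classical
  have : NeZero N := ⟨by omega⟩
  choose d₀ hsurj hd₀ using exists_demand_unique (N := N) (K := K) (by omega) hN
  -- Addition in `Fin N` is cyclic: for fixed `j`, `k` the requested file runs once through all
  -- files as `s` varies.
  let d : Fin N → Fin K → Demand N K := fun s j k => d₀ j k + s
  have hd : ∀ s j, Function.Surjective (d s j) := fun s j =>
    (Equiv.addRight s).surjective.comp (hsurj j)
  have hds : ∀ s j k, d s j k = s ↔ k = j := fun s j k => by simp [d, hd₀]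
  let z : Fin K → Setoid (Files N F) := fun k => Setoid.ker (S.cache k)
  let x : Fin N → Fin K → Setoid (Files N F) := fun s j => Setoid.ker (S.broadcast (d s j))
  have hz : ∀ k, entropy (z k) ≤ M * F := fun k => (entropy_ker_bits_le _).trans hS.1
  have hx : ∀ s j, entropy (x s j) ≤ R * F := fun s j =>
    (entropy_ker_bits_le _).trans (hS.2 _ (hd s j))
  have hdec : ∀ s j k, z k ⊓ x s j ≤ filePart (d s j k) := by
    intro s j k W W' h
    have h1 : S.cache k W = S.cache k W' := h.1
    have h2 : S.broadcast (d s j) W = S.broadcast (d s j) W' := h.2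
    change W _ = W' _
    rw [← S.decode_eq (d s j) k W, ← S.decode_eq (d s j) k W', h1, h2]
  have hgain : ∀ s, ∀ k, ∀ j ∈ Finset.univ.erase k,
      entropy (z k ⊓ otherFilesPart s ⊓ x s j) - entropy (z k ⊓ otherFilesPart s) ≤
        entropy (z k) + R * F - entropy (z k ⊓ filePart (d s j k)) := by
    intro s k j hj
    have hne : d s j k ≠ s := fun h => (Finset.ne_of_mem_erase hj) ((hds s j k).1 h).symm
    -- User `k ≠ j` decodes a file other than `s`, which is common to both sides; conditioning on
    -- that file instead of all the others only increases the cost of the message.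
    have h1 := entropy_inf_add_le (a := z k ⊓ otherFilesPart s) (b := z k ⊓ x s j)
      (c := z k ⊓ filePart (d s j k)) (inf_le_inf_left _ (otherFilesPart_le hne))
      (le_inf inf_le_left (hdec s j k))
    rw [← inf_inf_distrib_left, ← inf_assoc] at h1
    have h2 := entropy_inf_le (z k) (x s j)
    linarith [hx s j]
  have hfile : ∀ s, 2 * ((K : ℝ) - 1) * (N * F) + 2 * (((N : ℝ) - 1) * F) ≤
      ∑ k, (2 * entropy (z k ⊓ otherFilesPart s) + ∑ j ∈ Finset.univ.erase k,
        (entropy (z k) + R * F - entropy (z k ⊓ filePart (d s j k)))) := by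
    intro s
    have h1 := two_mul_entropy_bot_le (otherFilesPart s) z (x s) fun k => by
      rw [← otherFilesPart_inf_filePart s]
      refine le_inf (inf_le_left.trans inf_le_right) ?_
      have h := hdec s k k
      rw [(hds s k k).2 rfl] at h
      exact (inf_le_inf_right _ inf_le_left).trans h
    rw [entropy_bot_files] at h1
    have h2 := le_entropy_otherFilesPart (F := F) s
    refine le_trans (by linarith) (h1.trans (Finset.sum_le_sum fun k _ => ?_))
    exact add_le_add_right (Finset.sum_le_sum fun j hj => hgain s k j hj) _
  have hsum := Finset.sum_le_sum fun s (_ : s ∈ Finset.univ) => hfile s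
  rw [Finset.sum_comm (s := Finset.univ) (t := Finset.univ)] at hsum
  have hshift : ∀ j k, ∑ s, entropy (z k ⊓ filePart (d s j k)) =
      ∑ n, entropy (z k ⊓ filePart n) := fun j k =>
    Equiv.sum_comp (Equiv.addLeft (d₀ j k)) fun n => entropy (z k ⊓ filePart n)
  have hcache : ∀ k, ∑ s, (2 * entropy (z k ⊓ otherFilesPart s) + ∑ j ∈ Finset.univ.erase k,
        (entropy (z k) + R * F - entropy (z k ⊓ filePart (d s j k)))) ≤
      2 * (N * ((N : ℝ) - 1) * F) - N * ((K : ℝ) - 1) * F +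
        ((K : ℝ) + 1) * (M * F) + N * ((K : ℝ) - 1) * (R * F) := by
    intro k
    rw [Finset.sum_add_distrib, ← Finset.mul_sum, Finset.sum_comm]
    have hK : ((Finset.univ.erase k).card : ℝ) = K - 1 := by
      rw [Finset.card_erase_of_mem (Finset.mem_univ k), Finset.card_fin, Nat.cast_sub (by omega)]
      simp
    simp only [Finset.sum_sub_distrib, hshift, Finset.sum_const, Finset.card_univ,
      Fintype.card_fin, nsmul_eq_mul, hK]
    have h1 := le_sum_entropy_inf_filePart (z k)
    have h2 := sum_entropy_inf_otherFilesPart_le (z k)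
    -- The coefficient `2(N - 1) - (K - 1)` of the sum of the `H(Z, W_n)` is nonpositive, so a lower
    -- bound on that sum is what is needed. After substitution `H(Z)` has coefficient `K + 1`.
    have hD : (0 : ℝ) ≤ K + 1 - 2 * N := by
      have : (2 * N : ℝ) ≤ K + 1 := by exact_mod_cast hNK
      linarith
    have h3 := mul_le_mul_of_nonneg_left h1 hD
    have h4 := mul_le_mul_of_nonneg_left (hz k) (by positivity : (0 : ℝ) ≤ K + 1)
    nlinarith
  have htot := hsum.trans (Finset.sum_le_sum fun k _ => hcache k)
  simp only [Finset.sum_const, Finset.card_univ, Fintype.card_fin, nsmul_eq_mul] at htot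
  have hF' : (0 : ℝ) < F := by exact_mod_cast hF
  refine le_of_mul_le_mul_right ?_ hF'
  linarith

/-! ### Achievability by XOR delivery and memory sharing. -/

/-- A scheme with uncoded placement and XOR messages. The user `k` caches the bits of all files at
the positions `cached k`, and the message `q` is the sum over the users `k` of the bit at position
`p q k` of the file requested by `k`. -/
lemma exists_xor_scheme {N K F c : ℕ} {I Q : Type*} [Fintype I] [DecidableEq I] [Fintype Q]
    (hI : Fintype.card I = F) (cached : Fin K → Finset I) (hc : ∀ k, (cached k).card = c)
    (p : Q → Fin K → Option I)
    (hp : ∀ k i, i ∈ cached k ∨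
      ∃ q, p q k = some i ∧ ∀ k', k' ≠ k → ∀ i', p q k' = some i' → i' ∈ cached k) :
    ∃ S : Scheme N K F, S.UncodedPlacement ∧ S.cacheBits = N * c ∧
      ∀ d, S.deliveryBits d = Fintype.card Q := by
  classical
  let e : Fin F ≃ I := (Fintype.equivFinOfCardEq hI).symm
  let eQ : Fin (Fintype.card Q) ≃ Q := (Fintype.equivFin Q).symm
  have hcard : ∀ k, Fintype.card (Fin N × cached k) = N * c := fun k => by simp [hc k]
  let eC : ∀ k, Fin (N * c) ≃ Fin N × cached k := fun k =>
    (Fintype.equivFinOfCardEq (hcard k)).symm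
  let cache : Fin K → Files N F → (Fin (N * c) → Bool) := fun k W b =>
    W (eC k b).1 (e.symm (eC k b).2)
  -- Addition on `Bool` is XOR; a user with no position in the message contributes `0`.
  let term : Demand N K → Files N F → Q → Fin K → Bool := fun d W q k =>
    (p q k).elim 0 fun i => W (d k) (e.symm i)
  let broadcast : Demand N K → Files N F → (Fin (Fintype.card Q) → Bool) := fun d W b =>
    ∑ k, term d W (eQ b) k
  have hdec : ∀ d k W W', cache k W = cache k W' → broadcast d W = broadcast d W' →
      W (d k) = W' (d k) := by
    intro d k W W' h1 h2
    have hcached : ∀ n, ∀ i ∈ cached k, W n (e.symm i) = W' n (e.symm i) := by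
      intro n i hi
      have := congrFun h1 ((eC k).symm (n, ⟨i, hi⟩))
      simpa [cache] using this
    funext b
    rcases hp k (e b) with hb | ⟨q, hq, hq'⟩
    · simpa using hcached (d k) (e b) hb
    · have h3 := congrFun h2 (eQ.symm q)
      simp only [broadcast, Equiv.apply_symm_apply] at h3
      rw [← Finset.add_sum_erase _ _ (Finset.mem_univ k),
        ← Finset.add_sum_erase _ (term d W' q) (Finset.mem_univ k)] at h3
      have h4 : ∑ x ∈ Finset.univ.erase k, term d W q x =
          ∑ x ∈ Finset.univ.erase k, term d W' q x := by
        refine Finset.sum_congr rfl fun x hx => ?_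
        simp only [term]
        rcases hx' : p q x with _ | i'
        · rfl
        · exact hcached _ _ (hq' x (Finset.ne_of_mem_erase hx) i' hx')
      rw [h4] at h3
      have h5 := add_right_cancel h3
      simpa [term, hq] using h5
  refine ⟨{ cacheBits := N * c
            deliveryBits := fun _ => Fintype.card Q
            cache := cache
            broadcast := broadcast
            -- Decode through any library consistent with the observation; `hdec` makes the
            -- requested file independent of the choice.
            decode := fun d k z x =>
              if h : ∃ W, cache k W = z ∧ broadcast d W = x then h.choose (d k)
              else fun _ => false
            decode_eq := ?_ }, ?_, rfl, fun _ => rfl⟩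
  · intro d k W
    have h : ∃ W', cache k W' = cache k W ∧ broadcast d W' = broadcast d W := ⟨W, rfl, rfl⟩
    rw [dif_pos h]
    exact hdec d k _ _ h.choose_spec.1 h.choose_spec.2
  · intro k b
    exact ⟨(eC k b).1, e.symm (eC k b).2, fun W => rfl⟩

/-- Memory sharing between the placements in which every bit is missing at two users, at one user,
and at all users. -/
lemma exists_shared_scheme (N K q₁ q₂ l : ℕ) :
    ∃ S : Scheme N K (q₁ * (K * K - K) + q₂ * K + l), S.UncodedPlacement ∧
      S.cacheBits = N * (q₁ * ((K - 1) * (K - 1) - (K - 1)) + q₂ * (K - 1)) ∧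
      ∀ d, S.deliveryBits d = q₁ * (K * 2) + q₂ + l * K := by
  classical
  let P : Finset (Fin K) → Type := fun s => { x // x ∈ s.offDiag }
  let I := (Fin q₁ × P Finset.univ) ⊕ (Fin q₂ × Fin K) ⊕ Fin l
  let Q := (Fin q₁ × (Fin K × Bool)) ⊕ Fin q₂ ⊕ (Fin l × Fin K)
  let missing : I → Fin K → Prop := fun i k => match i with
    | .inl (_, x) => x.1.1 = k ∨ x.1.2 = k
    | .inr (.inl (_, j)) => j = k
    | .inr (.inr _) => True
  -- Bits missing at two users are indexed by ordered pairs. Message `(c, o)` serves everyone except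
  -- `c`, with the pairs that have `c` in the coordinate selected by `o`. Leftover bits are cached
  -- nowhere and sent to each user separately.
  let p : Q → Fin K → Option I := fun q k => match q with
    | .inl (q, (c, o)) => if h : k = c then none else
        some (.inl (q, bif o then ⟨(k, c), by simp [h]⟩ else ⟨(c, k), by simp [Ne.symm h]⟩))
    | .inr (.inl q) => some (.inr (.inl (q, k)))
    | .inr (.inr (i, j)) => if k = j then some (.inr (.inr i)) else none
  let cached : Fin K → Finset I := fun k => Finset.univ.filter fun i => ¬ missing i k
  have hcard : Fintype.card I = q₁ * (K * K - K) + q₂ * K + l := by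
    have hP : Fintype.card (P Finset.univ) = K * K - K := by
      rw [Fintype.card_coe, Finset.offDiag_card, Finset.card_fin]
    simp only [I, Fintype.card_sum, Fintype.card_prod, Fintype.card_fin, hP, add_assoc]
  have hQ : Fintype.card Q = q₁ * (K * 2) + q₂ + l * K := by
    simp [Q, add_assoc]
  have hc : ∀ k, (cached k).card = q₁ * ((K - 1) * (K - 1) - (K - 1)) + q₂ * (K - 1) := by
    intro k
    have h1 : cached k =
        ((Finset.univ : Finset (Fin q₁)) ×ˢ
          ((Finset.univ.erase k).offDiag.subtype (· ∈ Finset.univ.offDiag))).disjSum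
        (((Finset.univ : Finset (Fin q₂)) ×ˢ Finset.univ.erase k).disjSum ∅) := by
      ext i
      rcases i with ⟨q, ⟨⟨a, b⟩, hab⟩⟩ | ⟨q, j⟩ | i
      · have hab' : a ≠ b := by simpa using hab
        refine Iff.trans ?_ Finset.inl_mem_disjSum.symm
        simp [cached, missing, P, hab']
      · refine Iff.trans ?_ (Finset.inr_mem_disjSum.trans Finset.inl_mem_disjSum).symm
        simp [cached, missing]
      · refine Iff.trans ?_ (Finset.inr_mem_disjSum.trans Finset.inr_mem_disjSum).symm
        simp [cached, missing]
    rw [h1, Finset.card_disjSum, Finset.card_disjSum, Finset.card_product, Finset.card_product,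
      Finset.card_subtype, Finset.filter_true_of_mem, Finset.offDiag_card]
    · simp
    · intro x hx
      simpa using (Finset.mem_offDiag.1 hx).2.2
  have hp : ∀ k i, i ∈ cached k ∨
      ∃ q, p q k = some i ∧ ∀ k', k' ≠ k → ∀ i', p q k' = some i' → i' ∈ cached k := by
    intro k i
    by_cases hk : missing i k
    swap
    · exact Or.inl (by simp [cached, hk])
    right
    rcases i with ⟨q, ⟨⟨a, b⟩, hab⟩⟩ | ⟨q, j⟩ | i
    · have hab' : a ≠ b := by simpa using hab
      rcases hk with hk | hk
      · change a = k at hk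
        subst hk
        refine ⟨.inl (q, (b, true)), by simp [p, hab'], ?_⟩
        intro k' hk' i' hi'
        by_cases hkb : k' = b
        · simp [p, hkb] at hi'
        · simp only [p, dif_neg hkb, cond_true, Option.some.injEq] at hi'
          subst hi'
          simp [cached, missing, hk', hab'.symm]
      · change b = k at hk
        subst hk
        refine ⟨.inl (q, (a, false)), by simp [p, hab'.symm], ?_⟩
        intro k' hk' i' hi'
        by_cases hkb : k' = a
        · simp [p, hkb] at hi'
        · simp only [p, dif_neg hkb, cond_false, Option.some.injEq] at hi'
          subst hi'
          simp [cached, missing, hk', hab']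
    · change j = k at hk
      subst hk
      refine ⟨.inr (.inl q), rfl, ?_⟩
      intro k' hk' i' hi'
      simp only [p, Option.some.injEq] at hi'
      subst hi'
      simp [cached, missing, hk']
    · refine ⟨.inr (.inr (i, k)), by simp [p], ?_⟩
      intro k' hk' i' hi'
      simp [p, hk'] at hi'
  obtain ⟨S, h1, h2, h3⟩ := exists_xor_scheme (N := N) hcard cached hc p hp
  exact ⟨S, h1, h2, fun d => (h3 d).trans hQ⟩

/-- Splitting a file into a share `θ` for one placement and the rest for the other one. -/
lemma exists_split {K : ℕ} (hK : 3 ≤ K) {θ : ℝ} (h0 : 0 ≤ θ) (h1 : θ ≤ 1) (F : ℕ) :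
    ∃ q₁ q₂ l : ℕ, F = q₁ * (K * K - K) + q₂ * K + l ∧
      (q₁ : ℝ) * (K * (K - 1)) ≤ (1 - θ) * F ∧ (q₂ : ℝ) * K ≤ θ * F ∧ (l : ℝ) ≤ K * K := by
  have hK' : (3 : ℝ) ≤ K := by exact_mod_cast hK
  have hA : (0 : ℝ) < K * (K - 1) := by nlinarith
  have hB : (0 : ℝ) < K := by linarith
  have hF : (0 : ℝ) ≤ F := Nat.cast_nonneg F
  have hcast : ((K * K - K : ℕ) : ℝ) = K * (K - 1) := by
    rw [Nat.cast_sub (Nat.le_mul_self K)]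
    push_cast
    ring
  have hq₁ := (le_div_iff₀ hA).1 (Nat.floor_le (a := (1 - θ) * F / (K * (K - 1)))
    (div_nonneg (mul_nonneg (by linarith) hF) hA.le))
  have hq₂ := (le_div_iff₀ hB).1 (Nat.floor_le (a := θ * F / K)
    (div_nonneg (mul_nonneg h0 hF) hB.le))
  have hq₁' := (div_lt_iff₀ hA).1 (Nat.lt_floor_add_one ((1 - θ) * F / (K * (K - 1))))
  have hq₂' := (div_lt_iff₀ hB).1 (Nat.lt_floor_add_one (θ * F / K))
  set q₁ := ⌊(1 - θ) * F / (K * (K - 1))⌋₊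
  set q₂ := ⌊θ * F / K⌋₊
  have hle : q₁ * (K * K - K) + q₂ * K ≤ F := by
    have : ((q₁ * (K * K - K) + q₂ * K : ℕ) : ℝ) ≤ F := by
      push_cast [hcast]
      linarith
    exact_mod_cast this
  -- Each floor loses less than one block, in total less than `K(K-1) + K = K²` bits.
  refine ⟨q₁, q₂, F - (q₁ * (K * K - K) + q₂ * K), by omega, hq₁, hq₂, ?_⟩
  rw [Nat.cast_sub hle]
  push_cast [hcast]
  linarith

/-- Memory sharing achieves the segment between two corner points. -/
theorem uncodedAchievable_of_mem_segment {N K : ℕ} (hK : 3 ≤ K) {θ : ℝ} (h0 : 0 ≤ θ)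
    (h1 : θ ≤ 1) : UncodedAchievable N K (N / K * ((K : ℝ) - 2 + θ))
      (2 * (1 - θ) / ((K : ℝ) - 1) + θ / K) := by
  intro ε hε
  -- The at most `K²` leftover bits cost `K` transmissions each, hence the threshold `K³ ≤ εF`.
  refine ⟨⌈(K * K * K : ℝ) / ε⌉₊, fun F hF => ?_⟩
  have hF' : (K * K * K : ℝ) ≤ ε * F := by
    rw [← div_le_iff₀' hε]
    exact Nat.ceil_le.1 hF
  have hK' : (3 : ℝ) ≤ K := by exact_mod_cast hK
  have hK1 : (0 : ℝ) < K - 1 := by linarith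
  have hB : (0 : ℝ) < K := by linarith
  obtain ⟨q₁, q₂, l, hsplit, hq₁, hq₂, hl⟩ := exists_split hK h0 h1 F
  obtain ⟨S, hS, hcache, hdel⟩ := exists_shared_scheme N K q₁ q₂ l
  have hFR : (F : ℝ) = (q₁ * (K * K - K) + q₂ * K + l : ℕ) := by exact_mod_cast hsplit
  rw [hFR] at hF' hq₁ hq₂
  subst hsplit
  clear hFR
  refine ⟨S, hS, ?_, fun d _ => ?_⟩
  · have e1 : (((K - 1) * (K - 1) - (K - 1) : ℕ) : ℝ) = (K - 1) * (K - 2) := by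
      rw [Nat.cast_sub (Nat.le_mul_self _)]
      push_cast [Nat.cast_sub (show 1 ≤ K by omega)]
      ring
    have e2 : ((K - 1 : ℕ) : ℝ) = K - 1 := by
      push_cast [Nat.cast_sub (show 1 ≤ K by omega)]
      ring
    rw [hcache, Nat.cast_mul, Nat.cast_add, Nat.cast_mul, Nat.cast_mul, e1, e2]
    generalize ((q₁ * (K * K - K) + q₂ * K + l : ℕ) : ℝ) = F at *
    have h2 := mul_le_mul_of_nonneg_right hq₁ (by linarith : (0 : ℝ) ≤ K - 2)
    have h3 := mul_le_mul_of_nonneg_right hq₂ hK1.le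
    rw [div_mul_eq_mul_div, div_mul_eq_mul_div, le_div_iff₀ hB]
    have h4 : (q₁ * ((K - 1) * (K - 2)) + q₂ * (K - 1) : ℝ) * K ≤ (K - 2 + θ) * F := by
      linarith
    have h5 := mul_le_mul_of_nonneg_left h4 (Nat.cast_nonneg (α := ℝ) N)
    linarith
  · rw [hdel]
    generalize ((q₁ * (K * K - K) + q₂ * K + l : ℕ) : ℝ) = F at *
    push_cast
    have h2 : (q₁ * (K * 2) : ℝ) ≤ 2 * (1 - θ) / ((K : ℝ) - 1) * F := by
      rw [div_mul_eq_mul_div, le_div_iff₀ hK1]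
      linarith
    have h3 : (q₂ : ℝ) ≤ θ / K * F := by
      rw [div_mul_eq_mul_div, le_div_iff₀ hB]
      exact hq₂
    have h4 := mul_le_mul_of_nonneg_right hl hB.le
    linarith

end CodedCaching

/-! ### Matching the two bounds. -/

theorem mainTheorem5 (N K : ℕ) (hN : 2 ≤ N) (hNK : 2 * N ≤ K + 1) (M : ℝ)
    (hM : (N : ℝ) / K * ((K : ℝ) - 2) ≤ M) (hM' : M ≤ (N : ℝ) / K * ((K : ℝ) - 1)) :
    CodedCaching.IsExactRate N K M
        (((K : ℝ) ^ 2 + K - 2) / (K * ((K : ℝ) - 1)) - ((K : ℝ) + 1) / (N * ((K : ℝ) - 1)) * M) ∧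
      CodedCaching.UncodedAchievable N K M
        (((K : ℝ) ^ 2 + K - 2) / (K * ((K : ℝ) - 1)) - ((K : ℝ) + 1) / (N * ((K : ℝ) - 1)) * M) := by
  have hN' : (2 : ℝ) ≤ N := by exact_mod_cast hN
  have hK : 3 ≤ K := by omega
  have hK' : (3 : ℝ) ≤ K := by exact_mod_cast hK
  have hK1 : (0 : ℝ) < K - 1 := by linarith
  have hK0 : (0 : ℝ) < K := by linarith
  have hN0 : (0 : ℝ) < N := by linarith
  have hach : CodedCaching.UncodedAchievable N K M
      (((K : ℝ) ^ 2 + K - 2) / (K * ((K : ℝ) - 1)) -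
        ((K : ℝ) + 1) / (N * ((K : ℝ) - 1)) * M) := by
    have hr : (0 : ℝ) < N / K := by positivity
    convert CodedCaching.uncodedAchievable_of_mem_segment (N := N) hK
      (θ := M / (N / K) - (K - 2)) ?_ ?_ using 1
    · field_simp
      ring
    · field_simp
      ring
    · rw [sub_nonneg, le_div_iff₀' hr]
      exact hM
    · rw [sub_le_iff_le_add, div_le_iff₀' hr]
      linarith
  refine ⟨⟨?_, ?_⟩, hach⟩
  · intro ε hε
    obtain ⟨F₀, h⟩ := hach ε hε
    exact ⟨F₀, fun F hF => (h F hF).imp fun S hS => hS.2⟩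
  · intro R hR
    refine le_of_forall_pos_le_add fun ε hε => ?_
    obtain ⟨F₀, h⟩ := hR ε hε
    -- The outer bound holds at every positive file size, so one size suffices; `F₀ + 1` ensures
    -- positivity.
    obtain ⟨S, hS⟩ := h (F₀ + 1) (Nat.le_succ F₀)
    have hb := hS.le_of_two_mul_le hN hNK F₀.succ_pos
    have hpos : (0 : ℝ) < N * (K * (K - 1)) := by positivity
    refine le_of_mul_le_mul_left ?_ hpos
    have : (N : ℝ) * (K * (K - 1)) * (((K : ℝ) ^ 2 + K - 2) / (K * ((K : ℝ) - 1)) -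
        ((K : ℝ) + 1) / (N * ((K : ℝ) - 1)) * M) =
        N * (K - 1) * (K + 2) - K * (K + 1) * M := by
      field_simp
      ring
    linarith
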